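/- **Theorem (Distribution-Aware Explainability).** Let $U$ be a universal prefix-free Type-2 Turing machine. For $g:[0,1]^d\to\mathbb R$ let $K(g)\in\mathbb N\cup\{\infty\}$ be the length of a shortest program $p\in\{0,1\}^*$ such that, for every $x\in[0,1]^d$, every sequence $(q_i)$ of rational points with $\|x-q_i\|_2<2^{-i}$ for all $i$ and every $k\in\mathbb N$, $U(p,(q_i),k)$ halts with a rational $r$ satisfying $|g(x)-r|<2^{-k}$ (with $K(g)=\infty$ if there is no such program). For a probability distribution $D$ on $[0,1]^d$, $f:[0,1]^d\to\mathbb R$ and $\delta>0$ let $$\kappa_f^D(\delta)=\min\{k\in\mathbb N:\ \exists\, g:[0,1]^d\to\mathbb R \text{ with } K(g)\le k \text{ and } \mathbb E_{x\sim D}|f(x)-g(x)|\le\delta\}$$ (with $\kappa_f^D(\delta)=\infty$ if there is no such $k$). Let $N(\varepsilon)$ be the minimum number of axis-parallel boxes of side length $\varepsilon$ that cover the support of $D$, and suppose that the support of $D$ has box-counting dimension $d_B=\lim_{\varepsilon\to0}\frac{\log N(\varepsilon)}{\log(1/\varepsilon)}<d$. Then $$\kappa_f^D(\delta)=O\!\left(\left(\tfrac1\delta\right)^{d_B}\log\tfrac1\delta\right)$$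 in each of the following two senses. 1. For every computable $f:[0,1]^d\to\mathbb R$ (that is, some Type-2 Turing machine computes $f$ in the above sense) there is a constant $C>0$ such that $\kappa_f^D(\delta)\le C\,(1/\delta)^{d_B}\log(1/\delta)$ for all $0<\delta\le\frac12$. 2. If moreover $N(\varepsilon)=O(\varepsilon^{-d_B})$ as $\varepsilon\to0^+$ (in particular if $N(\varepsilon)=\Theta(\varepsilon^{-d_B})$), then for all $L\ge 0$ and $M\in\mathbb R$ there is a constant $C>0$ such that $\kappa_f^D(\delta)\le C\,(1/\delta)^{d_B}\log(1/\delta)$ for all $0<\delta\le\frac12$ and for all functions $f:[0,1]^d\to\mathbb R$, computable or not, that are $L$-Lipschitz for the Euclidean norm and satisfy $|f|\le M$. -/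

import Mathlib

open Set Filter Topology MeasureTheory Asymptotics
open scoped ENNReal NNReal

noncomputable section

namespace Explain

/-! ### Oracle computation -/

/-- Partial recursive functionals `Φ(α, n)`: the partial functions computed by Turing machines with
access to an infinite input `α : ℕ → ℕ`, uniformly in `α`. The clauses are those of `Nat.Partrec`
(and of `Nat.RecursiveIn`), together with the access to the infinite input. -/
inductive RecFunctional : ((ℕ → ℕ) → ℕ →. ℕ) → Prop
  | zero : RecFunctional fun _ _ => Part.some 0
  | succ : RecFunctional fun _ n => Part.some (n + 1)
  | left : RecFunctional fun _ n => Part.some n.unpair.1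
  | right : RecFunctional fun _ n => Part.some n.unpair.2
  | oracle : RecFunctional fun α n => Part.some (α n)
  | pair {Φ Ψ : (ℕ → ℕ) → ℕ →. ℕ} (hΦ : RecFunctional Φ) (hΨ : RecFunctional Ψ) :
      RecFunctional fun α n => Nat.pair <$> Φ α n <*> Ψ α n
  | comp {Φ Ψ : (ℕ → ℕ) → ℕ →. ℕ} (hΦ : RecFunctional Φ) (hΨ : RecFunctional Ψ) :
      RecFunctional fun α n => Ψ α n >>= Φ α
  | prec {Φ Ψ : (ℕ → ℕ) → ℕ →. ℕ} (hΦ : RecFunctional Φ) (hΨ : RecFunctional Ψ) :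
      RecFunctional fun α p =>
        p.unpair.2.rec (Φ α p.unpair.1) fun y IH => do
          let i ← IH
          Ψ α (Nat.pair p.unpair.1 (Nat.pair y i))
  | rfind {Φ : (ℕ → ℕ) → ℕ →. ℕ} (hΦ : RecFunctional Φ) :
      RecFunctional fun α a => Nat.rfind fun n => (fun m => decide (m = 0)) <$> Φ α (Nat.pair a n)

/-- A (not necessarily effective) device that receives a program `p ∈ {0,1}*`, an infinite input
and an accuracy parameter, and may output a natural number. -/
abbrev Machine : Type := List Bool → (ℕ → ℕ) → ℕ →. ℕ

/-- `V` is carried out by a Type-2 Turing machine. -/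
def Machine.IsEffective (V : Machine) : Prop :=
  ∃ Φ : (ℕ → ℕ) → ℕ →. ℕ, RecFunctional Φ ∧
    ∀ (p : List Bool) (α : ℕ → ℕ) (k : ℕ), V p α k = Φ α (Nat.pair (Encodable.encode p) k)

/-- The programs of `V` are prefix-free: for every input, no halting program is a proper prefix of
another halting program. -/
def Machine.IsPrefixFree (V : Machine) : Prop :=
  ∀ (α : ℕ → ℕ) (k : ℕ) (p p' : List Bool),
    (V p α k).Dom → (V p' α k).Dom → p <+: p' → p = p'

/-- `U` is a universal prefix-free Type-2 Turing machine: it simulates every prefix-free Type-2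
Turing machine, and the programs become longer by at most a constant. -/
def Machine.IsUniversal (U : Machine) : Prop :=
  U.IsEffective ∧ U.IsPrefixFree ∧
    ∀ V : Machine, V.IsEffective → V.IsPrefixFree →
      ∃ c : ℕ, ∀ p : List Bool, ∃ p' : List Bool, p'.length ≤ p.length + c ∧
        ∀ (α : ℕ → ℕ) (k : ℕ), U p' α k = V p α k

/-! ### Computable real functions on the cube and their Kolmogorov complexity -/

/-- The unit cube `[0,1]^d`, with the Euclidean metric. -/
abbrev Cube (d : ℕ) : Type :=
  {x : EuclideanSpace ℝ (Fin d) // ∀ i, x i ∈ Icc (0 : ℝ) 1}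

/-- The standard numbering of the rational numbers: `⟨⟨a, b⟩, c⟩` denotes `(a - b) / (c + 1)`. -/
def ratOfNat (n : ℕ) : ℚ :=
  ((n.unpair.1.unpair.1 : ℚ) - (n.unpair.1.unpair.2 : ℚ)) / ((n.unpair.2 : ℚ) + 1)

/-- The `i`-th point of the sequence in `ℚ^d` that is written on the infinite input `α`. -/
def oraclePoint (d : ℕ) (α : ℕ → ℕ) (i : ℕ) : EuclideanSpace ℝ (Fin d) :=
  WithLp.toLp 2 fun j : Fin d => ((ratOfNat (α (Nat.pair i j)) : ℚ) : ℝ)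

/-- `α` is a rapidly converging Cauchy sequence of rational points with limit `x`. -/
def IsName {d : ℕ} (α : ℕ → ℕ) (x : Cube d) : Prop :=
  ∀ i : ℕ, dist (x : EuclideanSpace ℝ (Fin d)) (oraclePoint d α i) < (2 : ℝ)⁻¹ ^ i

/-- The functional `Φ` computes `g`: on every name of `x` and every accuracy `k` it halts with a
rational number at distance less than `2⁻ᵏ` from `g x`. -/
def Computes {d : ℕ} (Φ : (ℕ → ℕ) → ℕ →. ℕ) (g : Cube d → ℝ) : Prop :=
  ∀ (x : Cube d) (α : ℕ → ℕ), IsName α x → ∀ k : ℕ,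
    ∃ n ∈ Φ α k, |g x - ((ratOfNat n : ℚ) : ℝ)| < (2 : ℝ)⁻¹ ^ k

/-- Computable real functions on `[0,1]^d`. -/
def IsComputable {d : ℕ} (g : Cube d → ℝ) : Prop :=
  ∃ Φ : (ℕ → ℕ) → ℕ →. ℕ, RecFunctional Φ ∧ Computes Φ g

/-- The Kolmogorov complexity of `g` with respect to `U`; it is `⊤` if no program computes `g`. -/
def kolmogorov (U : Machine) {d : ℕ} (g : Cube d → ℝ) : ℕ∞ :=
  ⨅ (p : List Bool) (_ : Computes (U p) g), (p.length : ℕ∞)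

/-! ### Explanations -/

/-- The functions of complexity at most `k`. -/
def interpretabilityClass (U : Machine) (d k : ℕ) : Set (Cube d → ℝ) :=
  {g | kolmogorov U g ≤ k}

/-- The expected error `𝔼_{x ∼ D} |f x - g x|`. -/
def expectedError {d : ℕ} (D : Measure (Cube d)) (f g : Cube d → ℝ) : ℝ≥0∞ :=
  ∫⁻ x, ENNReal.ofReal |f x - g x| ∂D

/-- The minimal complexity of an explanation of `f` with expected error at most `δ` under `D`; it
is `⊤` if there is no such explanation. -/
def explanationComplexity (U : Machine) {d : ℕ} (D : Measure (Cube d)) (f : Cube d → ℝ)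
    (δ : ℝ) : ℕ∞ :=
  ⨅ (k : ℕ) (_ : ∃ g ∈ interpretabilityClass U d k, expectedError D f g ≤ ENNReal.ofReal δ),
    (k : ℕ∞)

/-! ### Box-counting dimension -/

/-- The axis-parallel closed box of side length `ε` with lower corner `c`. -/
def box {d : ℕ} (c : EuclideanSpace ℝ (Fin d)) (ε : ℝ) : Set (EuclideanSpace ℝ (Fin d)) :=
  {x | ∀ i, c i ≤ x i ∧ x i ≤ c i + ε}

/-- The least number of boxes of side length `ε` that cover `S`. -/
def boxCount {d : ℕ} (S : Set (EuclideanSpace ℝ (Fin d))) (ε : ℝ) : ℕ :=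
  sInf {n : ℕ | ∃ C : Finset (EuclideanSpace ℝ (Fin d)), C.card = n ∧ S ⊆ ⋃ c ∈ C, box c ε}

/-- The box-counting dimension of `S` exists and equals `s`. -/
def HasBoxDim {d : ℕ} (S : Set (EuclideanSpace ℝ (Fin d))) (s : ℝ) : Prop :=
  Tendsto (fun ε : ℝ => Real.log (boxCount S ε) / Real.log (1 / ε)) (𝓝[>] 0) (𝓝 s)

/-- The support of `D`, as a subset of `ℝ^d`. -/
def suppSet {d : ℕ} (D : Measure (Cube d)) : Set (EuclideanSpace ℝ (Fin d)) :=
  Subtype.val '' D.support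

end Explain

end

/-! A computable `f` explains itself: universality gives it a program, whose constant length is
absorbed because `(1/δ)^dB * log (1/δ) ≥ 1/2`.

For Lipschitz `f` with `|f| ≤ μ`, cover the support by `N` boxes of side `2⁻q`, a scale comparable
to `δ`. Choose a support point in each box that meets the support and round it to a grid point `z
i`. The lower McShane envelope `max_i (f (z i) - Λ * ‖x - z i‖₁)`, with heights rounded down and
truncated below at `-μ`, lies below `f` and is within `O(2⁻q)` of it on the support
(`exists_coneMax_approx`). It is described by `(d + 1) * N` digits of `O(q)` bits each, that is, by
`O(δ^(-dB) * log (1/δ))` bits.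

One prefix-free machine, depending only on `d`, `Λ`, `μ`, evaluates all such envelopes from these
descriptions (`coneMachine_computes`, `exists_coneMachine_program`). The universal machine simulates
it with a constant overhead, so the bound is uniform in `f`. Scaling everything to natural numbers
makes its arithmetic primitive recursive, and this gives effectiveness. -/

namespace Explain

/-! ### Effective machines -/

namespace RecFunctional

theorem of_partrec {f : ℕ →. ℕ} (hf : Nat.Partrec f) : RecFunctional fun _ n => f n := by
  induction hf with
  | zero => exact zero
  | succ => exact succ
  | left => exact left
  | right => exact right
  | pair _ _ ihf ihg => exact pair ihf ihg
  | comp _ _ ihf ihg => exact comp ihf ihg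
  | prec _ _ ihf ihg => exact prec ihf ihg
  | rfind _ ihf => exact rfind ihf

theorem of_primrec {f : ℕ → ℕ} (hf : Primrec f) : RecFunctional fun _ n => Part.some (f n) :=
  of_partrec (Nat.Partrec.of_primrec (Primrec.nat_iff.1 hf))

theorem pair_total {F G : (ℕ → ℕ) → ℕ → ℕ} (hF : RecFunctional fun α n => Part.some (F α n))
    (hG : RecFunctional fun α n => Part.some (G α n)) :
    RecFunctional fun α n => Part.some (Nat.pair (F α n) (G α n)) := by
  have h := hF.pair hG
  simpa [Seq.seq] using h

theorem comp_total {F G : (ℕ → ℕ) → ℕ → ℕ} (hF : RecFunctional fun α n => Part.some (F α n))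
    (hG : RecFunctional fun α n => Part.some (G α n)) :
    RecFunctional fun α n => Part.some (F α (G α n)) := by
  have h := hF.comp hG
  simpa using h

/-- Reading finitely many entries of the infinite input. -/
theorem map_oracle {J : ℕ → ℕ} (hJ : Primrec J) (l : List ℕ) :
    RecFunctional fun α n =>
      Part.some (Encodable.encode (l.map fun j => α (Nat.pair (J n) j))) := by
  induction l with
  | nil => simpa using zero
  | cons j l ih =>
    have h1 : RecFunctional fun α n => Part.some (α (Nat.pair (J n) j)) :=
      comp_total oracle (of_primrec (Primrec₂.natPair.comp hJ (Primrec.const j)))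
    have h2 := comp_total succ (pair_total h1 ih)
    simpa using h2

end RecFunctional

/-- A machine that, on valid programs, reads finitely many points of the infinite input and then
works on them primitive recursively. -/
theorem Machine.isEffective_of_primrec (d : ℕ) {valid : List Bool → Prop} [DecidablePred valid]
    (hv : PrimrecPred valid) {I : List Bool × ℕ → ℕ} (hI : Primrec I)
    {H : List Bool × ℕ → List ℕ → ℕ} (hH : Primrec₂ H) :
    Machine.IsEffective fun p α k =>
      if valid p then
        Part.some (H (p, k) ((List.range d).map fun j => α (Nat.pair (I (p, k)) j)))
      else Part.none := by
  let f : (List Bool × ℕ) × List ℕ →. ℕ := fun a =>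
    ((if valid a.1.1 then some (H a.1 a.2) else none : Option ℕ) : Part ℕ)
  have hf : Partrec f := by
    refine Computable.ofOption (Primrec.to_comp ?_)
    exact Primrec.ite (hv.comp (Primrec.fst.comp Primrec.fst))
      (Primrec.option_some.comp (hH.comp Primrec.fst Primrec.snd)) (Primrec.const none)
  let J : ℕ → ℕ := fun z => (Option.map I (Encodable.decode z)).getD 0
  have hJ : Primrec J :=
    Primrec.option_getD.comp (Primrec.option_map Primrec.decode (hI.comp Primrec.snd).to₂)
      (Primrec.const 0)
  refine ⟨_, (RecFunctional.of_partrec hf).comp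
    (RecFunctional.pair_total (RecFunctional.of_primrec Primrec.id)
      (RecFunctional.map_oracle hJ (List.range d))), fun p α k => ?_⟩
  have hJz : J (Nat.pair (Encodable.encode p) k) = I (p, k) := by
    simp [J, Encodable.decode_prod_val]
  simp only [hJz, id]
  by_cases h : valid p <;> simp [h, f]

/-- A single functional is simulated by the machine whose only halting program is empty. -/
theorem IsComputable.exists_program {U : Machine} (hU : U.IsUniversal) {d : ℕ} {f : Cube d → ℝ}
    (hf : IsComputable f) : ∃ p : List Bool, Computes (U p) f := by
  obtain ⟨Φ, hΦ, hc⟩ := hf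
  let V : Machine := fun p α k => if p = [] then Φ α k else Part.none
  have hV : V.IsEffective := by
    -- The empty program has code `0`, so testing the first component recognises it.
    let t : ℕ →. ℕ := fun z => ((if z.unpair.1 = 0 then some z.unpair.2 else none : Option ℕ) :
      Part ℕ)
    have ht : Partrec t := by
      refine Computable.ofOption (Primrec.to_comp ?_)
      exact Primrec.ite (Primrec.eq.comp (Primrec.fst.comp Primrec.unpair) (Primrec.const 0))
        (Primrec.option_some.comp (Primrec.snd.comp Primrec.unpair)) (Primrec.const none)
    refine ⟨_, hΦ.comp (RecFunctional.of_partrec (Partrec.nat_iff.1 ht)), fun p α k => ?_⟩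
    cases p with
    | nil => simpa [V, t] using show Φ α k = Part.some k >>= Φ α from (Part.bind_some k (Φ α)).symm
    | cons b p => simpa [V, t] using show Part.none = Part.none >>= Φ α from (Part.bind_none (Φ α)).symm
  have hV' : V.IsPrefixFree := by
    intro α k p p' hp hp' _
    have aux : ∀ q, (V q α k).Dom → q = [] := by
      intro q hq
      by_contra h
      simp [V, h] at hq
    rw [aux p hp, aux p' hp']
  obtain ⟨c, hc'⟩ := hU.2.2 V hV hV'
  obtain ⟨p, -, hp⟩ := hc' []
  refine ⟨p, fun x α hα k => ?_⟩
  rw [hp]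
  simpa [V] using hc x α hα k

/-! ### A prefix-free code for natural numbers -/

/-- The number with binary digits `l`, least significant digit first. -/
def bitsVal (l : List Bool) : ℕ :=
  l.foldr (fun b n => 2 * n + cond b 1 0) 0

theorem exists_bitsVal (s : ℕ) : ∀ m < 2 ^ s, ∃ l : List Bool, l.length = s ∧ bitsVal l = m := by
  induction s with
  | zero => intro m hm; exact ⟨[], rfl, by simp [bitsVal]; omega⟩
  | succ s ih =>
    intro m hm
    obtain ⟨l, hl, hv⟩ := ih (m / 2) (by omega)
    refine ⟨decide (m % 2 = 1) :: l, by simp [hl], ?_⟩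
    change 2 * bitsVal l + _ = m
    rw [hv]
    rcases Nat.mod_two_eq_zero_or_one m with h | h <;> simp [h] <;> omega

/-- The length of the initial block of ones. -/
def ones (p : List Bool) : ℕ := p.idxOf false

/-- What follows the initial block of ones and the first zero. -/
def afterOnes (p : List Bool) : List Bool := p.drop (ones p + 1)

/-- The self-delimiting words `1^ℓ 0 w` with `|w| = ℓ`. -/
def IsDelimited (p : List Bool) : Prop := p.length = 2 * ones p + 1

instance : DecidablePred IsDelimited := fun p => inferInstanceAs (Decidable (p.length = _))

theorem ones_replicate (n : ℕ) (w : List Bool) :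
    ones (List.replicate n true ++ false :: w) = n := by
  induction n with
  | zero => simp [ones]
  | succ n ih =>
    rw [List.replicate_succ, List.cons_append, ones, List.idxOf_cons_ne _ (by simp)]
    exact congrArg _ ih

theorem afterOnes_replicate (n : ℕ) (w : List Bool) :
    afterOnes (List.replicate n true ++ false :: w) = w := by
  rw [afterOnes, ones_replicate]
  simp [List.drop_append]

/-- A delimited word already contains its first zero, so extending it leaves `ones` unchanged;
`ones` in turn fixes the length. -/
theorem IsDelimited.eq_of_prefix {p p' : List Bool} (hp : IsDelimited p) (hp' : IsDelimited p')
    (h : p <+: p') : p = p' := by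
  obtain ⟨t, rfl⟩ := h
  have hmem : false ∈ p := List.idxOf_lt_length_iff.1 (by unfold IsDelimited ones at hp; omega)
  have h1 : ones (p ++ t) = ones p := List.idxOf_append_of_mem hmem
  unfold IsDelimited at hp hp'
  rw [h1, List.length_append] at hp'
  have : t = [] := List.length_eq_zero_iff.1 (by omega)
  simp [this]

theorem primrec_bitsVal : Primrec bitsVal := by
  refine Primrec.list_foldr (h := fun _ (q : Bool × ℕ) => 2 * q.2 + cond q.1 1 0)
    Primrec.id (Primrec.const 0) ?_
  exact (Primrec.nat_add.comp (Primrec.nat_double.comp (Primrec.snd.comp Primrec.snd))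
    (Primrec.cond (Primrec.fst.comp Primrec.snd) (Primrec.const 1) (Primrec.const 0))).to₂

theorem primrec_ones : Primrec ones :=
  Primrec.list_idxOf.comp (Primrec.const false) Primrec.id

theorem primrec_afterOnes : Primrec afterOnes :=
  Primrec.list_drop.comp (Primrec.succ.comp primrec_ones) Primrec.id

theorem primrecPred_isDelimited : PrimrecPred IsDelimited :=
  Primrec.eq.comp Primrec.list_length (Primrec.nat_double_succ.comp primrec_ones)

/-! ### Digits -/

/-- The `i`-th digit of `m` in base `b`. -/
def digit (b m i : ℕ) : ℕ := m / b ^ i % b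

/-- Lets a program omit the number of its cones: cones read beyond the encoded ones have height `0`
and do no harm. -/
theorem digit_eq_zero {b m n i : ℕ} (hb : 0 < b) (hm : m < b ^ n) (hi : n ≤ i) :
    digit b m i = 0 := by
  rw [digit, Nat.div_eq_of_lt (hm.trans_le (Nat.pow_le_pow_right hb hi)), Nat.zero_mod]

theorem exists_digits {b : ℕ} (n : ℕ) : ∀ e : ℕ → ℕ, (∀ i < n, e i < b) →
    ∃ m < b ^ n, ∀ i < n, digit b m i = e i := by
  induction n with
  | zero => intro e _; exact ⟨0, by simp, by simp⟩
  | succ n ih =>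
    intro e he
    obtain ⟨m, hm, hd⟩ := ih (fun i => e (i + 1)) fun i hi => he _ (by omega)
    have h0 := he 0 (by omega)
    refine ⟨e 0 + b * m, ?_, ?_⟩
    · calc e 0 + b * m < b + b * m := by omega
        _ = b * (m + 1) := by ring
        _ ≤ b * b ^ n := Nat.mul_le_mul_left _ hm
        _ = b ^ (n + 1) := by ring
    · rintro (_ | i) hi
      · simp [digit, Nat.mod_eq_of_lt h0]
      · rw [← hd i (by omega), digit, pow_succ', ← Nat.div_div_eq_div_mul,
          Nat.add_mul_div_left _ _ (by omega), Nat.div_eq_of_lt h0, zero_add, digit]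

theorem primrec_pow : Primrec₂ fun a b : ℕ => a ^ b :=
  Primrec₂.unpaired'.1 Nat.Primrec.pow

theorem primrec_digit {α : Type*} [Primcodable α] {b m i : α → ℕ} (hb : Primrec b)
    (hm : Primrec m) (hi : Primrec i) : Primrec fun a => digit (b a) (m a) (i a) :=
  Primrec.nat_mod.comp (Primrec.nat_div.comp hm (primrec_pow.comp hb hi)) hb

/-! ### Finite sums and maxima -/

theorem primrec_sum {α : Type*} [Primcodable α] {n : α → ℕ} {F : α → ℕ → ℕ} (hn : Primrec n)
    (hF : Primrec₂ F) : Primrec fun a => ∑ i ∈ Finset.range (n a), F a i := by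
  refine (Primrec.nat_rec' (h := fun a (q : ℕ × ℕ) => q.2 + F a q.1) hn (Primrec.const 0)
    (Primrec.nat_add.comp (Primrec.snd.comp Primrec.snd)
      (hF.comp Primrec.fst (Primrec.fst.comp Primrec.snd))).to₂).of_eq fun a => ?_
  induction n a with
  | zero => rfl
  | succ n ih => rw [Finset.sum_range_succ, ← ih]

/-- The maximum of `0` and of `F 0, …, F (n - 1)`. -/
def maxBelow {R : Type*} [Zero R] [Max R] (F : ℕ → R) : ℕ → R
  | 0 => 0
  | n + 1 => max (maxBelow F n) (F n)

theorem primrec_maxBelow {α : Type*} [Primcodable α] {n : α → ℕ} {F : α → ℕ → ℕ}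
    (hn : Primrec n) (hF : Primrec₂ F) : Primrec fun a => maxBelow (F a) (n a) := by
  refine (Primrec.nat_rec' (h := fun a (q : ℕ × ℕ) => max q.2 (F a q.1)) hn (Primrec.const 0)
    (Primrec.nat_max.comp (Primrec.snd.comp Primrec.snd)
      (hF.comp Primrec.fst (Primrec.fst.comp Primrec.snd))).to₂).of_eq fun a => ?_
  induction n a with
  | zero => rfl
  | succ n ih => rw [maxBelow, ← ih]

theorem le_maxBelow {F : ℕ → ℝ} {n i : ℕ} (hi : i < n) : F i ≤ maxBelow F n := by
  induction n with
  | zero => omega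
  | succ n ih =>
    rcases Nat.lt_succ_iff_lt_or_eq.1 hi with h | rfl
    · exact (ih h).trans (le_max_left _ _)
    · exact le_max_right _ _

theorem maxBelow_le {F : ℕ → ℝ} {n : ℕ} {c : ℝ} (hc : 0 ≤ c) (h : ∀ i < n, F i ≤ c) :
    maxBelow F n ≤ c := by
  induction n with
  | zero => exact hc
  | succ n ih => exact max_le (ih fun i hi => h i (by omega)) (h n (by omega))

/-- Approximating a maximum of reals by the corresponding maximum of natural numbers, where
negative entries are truncated. -/
theorem abs_maxBelow_sub_le {F : ℕ → ℝ} {A B : ℕ → ℕ} {t e : ℝ} (ht : 0 < t) (he : 0 ≤ e) {n : ℕ}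
    (h : ∀ i < n, |F i * t - ((A i : ℝ) - B i)| ≤ e) :
    |maxBelow F n * t - (maxBelow (fun i => A i - B i) n : ℕ)| ≤ e := by
  induction n with
  | zero => simpa [maxBelow] using he
  | succ n ih =>
    have h1 := abs_le.1 (ih fun i hi => h i (by omega))
    have h2 := abs_le.1 (h n (by omega))
    have h0 : (0 : ℝ) ≤ (maxBelow (fun i => A i - B i) n : ℕ) := Nat.cast_nonneg _
    have hx : (((A n - B n : ℕ) : ℕ) : ℝ) = max ((A n : ℝ) - B n) 0 := by
      rcases le_total (B n) (A n) with hab | hab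
      · rw [Nat.cast_sub hab, max_eq_left]
        exact sub_nonneg.2 (by exact_mod_cast hab)
      · rw [Nat.sub_eq_zero_of_le hab, max_eq_right, Nat.cast_zero]
        exact sub_nonpos.2 (by exact_mod_cast hab)
    rw [maxBelow, maxBelow, max_mul_of_nonneg _ _ ht.le, Nat.cast_max, hx, abs_le]
    set a := maxBelow F n * t
    set b : ℝ := ((maxBelow (fun i => A i - B i) n : ℕ) : ℝ)
    constructor
    · have : max b (max ((A n : ℝ) - B n) 0) ≤ max a (F n * t) + e := by
        refine max_le ?_ (max_le ?_ ?_)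
        · linarith [le_max_left a (F n * t)]
        · linarith [le_max_right a (F n * t)]
        · linarith [le_max_left a (F n * t)]
      linarith
    · have : max a (F n * t) ≤ max b (max ((A n : ℝ) - B n) 0) + e := by
        refine max_le ?_ ?_
        · linarith [le_max_left b (max ((A n : ℝ) - B n) 0)]
        · linarith [le_max_right b (max ((A n : ℝ) - B n) 0), le_max_left ((A n : ℝ) - B n) 0]
      linarith

/-! ### Rounding the coordinates of rational points -/

/-- The integer part of `T` times the positive part of the rational number with number `a`. -/
def roundCoord (T a : ℕ) : ℕ :=
  (a.unpair.1.unpair.1 - a.unpair.1.unpair.2) * T / (a.unpair.2 + 1)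

theorem primrec_roundCoord : Primrec₂ roundCoord := by
  have h1 := Primrec.unpair.comp (Primrec.snd : Primrec (Prod.snd : ℕ × ℕ → ℕ))
  have h2 := Primrec.unpair.comp (Primrec.fst.comp h1)
  exact (Primrec.nat_div.comp (Primrec.nat_mul.comp
    (Primrec.nat_sub.comp (Primrec.fst.comp h2) (Primrec.snd.comp h2)) Primrec.fst)
    (Primrec.succ.comp (Primrec.snd.comp h1))).to₂

/-- Truncating the rational at `0` does not move it away from `x ≥ 0`. Scaling turns the error `e`
into `e * T`, and integer division costs at most `1`. -/
theorem abs_mul_sub_roundCoord_le {x e : ℝ} (hx : 0 ≤ x) (T : ℕ) {a : ℕ}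
    (h : |x - ((ratOfNat a : ℚ) : ℝ)| ≤ e) : |x * T - roundCoord T a| ≤ e * T + 1 := by
  set u := a.unpair.1.unpair.1
  set v := a.unpair.1.unpair.2
  set w := a.unpair.2
  have hw : (0 : ℝ) < (w : ℝ) + 1 := by positivity
  have hT : (0 : ℝ) ≤ T := Nat.cast_nonneg _
  have hr : ((ratOfNat a : ℚ) : ℝ) = ((u : ℝ) - v) / (w + 1) := by
    simp only [ratOfNat]; push_cast; rfl
  rw [hr] at h
  set y : ℝ := ((u - v : ℕ) : ℝ) / (w + 1) with hy
  have h1 : |x - y| ≤ e := by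
    rcases le_total v u with huv | huv
    · rwa [hy, Nat.cast_sub huv]
    · have h0 : y = 0 := by simp [hy, Nat.sub_eq_zero_of_le huv]
      have hle : ((u : ℝ) - v) / (w + 1) ≤ 0 :=
        div_nonpos_of_nonpos_of_nonneg (sub_nonpos.2 (by exact_mod_cast huv)) hw.le
      rw [h0, sub_zero, abs_of_nonneg hx]
      linarith [le_abs_self (x - ((u : ℝ) - v) / (w + 1))]
  have h2 : (roundCoord T a : ℝ) ≤ y * T := by
    have := @Nat.cast_div_le ℝ _ _ _ ((u - v) * T) (w + 1)
    calc (roundCoord T a : ℝ) ≤ (((u - v) * T : ℕ) : ℝ) / ((w + 1 : ℕ) : ℝ) := this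
      _ = y * T := by rw [hy]; push_cast; ring
  have h3 : y * T ≤ roundCoord T a + 1 := by
    have h4 : (u - v) * T < (roundCoord T a + 1) * (w + 1) :=
      Nat.lt_mul_of_div_lt (Nat.lt_succ_self _) (Nat.succ_pos _)
    have h5 : (((u - v : ℕ) : ℝ)) * T ≤ (roundCoord T a + 1) * (w + 1) := by exact_mod_cast h4.le
    rw [hy, div_mul_eq_mul_div, div_le_iff₀ hw]
    exact h5
  have h6 : |x * T - y * T| ≤ e * T := by
    rw [← sub_mul, abs_mul, abs_of_nonneg hT]
    exact mul_le_mul_of_nonneg_right h1 hT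
  have h7 := abs_le.1 h6
  rw [abs_le]
  constructor <;> linarith [h7.1, h7.2]

theorem coord_abs_sub_le_dist {d : ℕ} (x y : EuclideanSpace ℝ (Fin d)) (j : Fin d) :
    |x j - y j| ≤ dist x y := by
  rw [dist_eq_norm, ← Real.norm_eq_abs]
  exact PiLp.norm_apply_le (x - y) j

theorem dist_le_sum_abs_sub {d : ℕ} (x y : EuclideanSpace ℝ (Fin d)) :
    dist x y ≤ ∑ j, |x j - y j| := by
  rw [EuclideanSpace.dist_eq]
  refine Real.sqrt_le_iff.2 ⟨Finset.sum_nonneg fun j _ => abs_nonneg _, ?_⟩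
  refine (Finset.sum_le_sum fun j _ => ?_).trans
    (Finset.sum_sq_le_sq_sum_of_nonneg fun j _ => abs_nonneg (x j - y j))
  rw [Real.dist_eq]

/-! ### Maxima of cones -/

/-- The maximum of `-μ` and of the first `n` cones of slope `Λ` whose apices have as coordinates
the digits of `m` in base `2 ^ (q + 2 * μ + 1)`, divided by `2 ^ q`. -/
noncomputable def coneMax (d Λ μ q m n : ℕ) (x : Cube d) : ℝ :=
  maxBelow (fun i =>
    (digit (2 ^ (q + 2 * μ + 1)) m (i * (d + 1) + d) : ℝ) / 2 ^ q -
      Λ * ∑ j : Fin d,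
        |x.1 j - (digit (2 ^ (q + 2 * μ + 1)) m (i * (d + 1) + j) : ℝ) / 2 ^ q|) n - μ

/-- The parameter `q` in a program for a maximum of cones. -/
def resolution (p : List Bool) : ℕ := ones (afterOnes p)

/-- The parameter `m` in a program for a maximum of cones. -/
def payload (p : List Bool) : ℕ := bitsVal (afterOnes (afterOnes p))

/-- The value in `ℕ` of a maximum of cones, scaled by `2 ^ (t + q)`, at the point with scaled
coordinates `z`. -/
def coneMaxNat (d Λ μ q m n t : ℕ) (z : ℕ → ℕ) : ℕ :=
  maxBelow (fun i =>
    digit (2 ^ (q + 2 * μ + 1)) m (i * (d + 1) + d) * 2 ^ t -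
      Λ * ∑ j ∈ Finset.range d,
        ((z j - digit (2 ^ (q + 2 * μ + 1)) m (i * (d + 1) + j) * 2 ^ t) +
          (digit (2 ^ (q + 2 * μ + 1)) m (i * (d + 1) + j) * 2 ^ t - z j))) n

theorem cast_sub_add_sub (a b : ℕ) : (((a - b) + (b - a) : ℕ) : ℝ) = |(a : ℝ) - b| := by
  rcases le_total a b with h | h
  · rw [Nat.sub_eq_zero_of_le h, zero_add, Nat.cast_sub h, abs_sub_comm, abs_of_nonneg]
    exact sub_nonneg.2 (by exact_mod_cast h)
  · rw [Nat.sub_eq_zero_of_le h, add_zero, Nat.cast_sub h, abs_of_nonneg]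
    exact sub_nonneg.2 (by exact_mod_cast h)

/-- Apices and heights are dyadic and become exact integers after scaling, so only the `d`
coordinates of `x` carry an error. Each contributes at most `2`, amplified by the slope `Λ`; taking
maxima does not increase the error. -/
theorem abs_coneMax_sub_coneMaxNat_le {d Λ μ q m n t : ℕ} {x : Cube d} {z : ℕ → ℕ}
    (hz : ∀ j : Fin d, |x.1 j * 2 ^ (t + q) - z j| ≤ 2) :
    |(coneMax d Λ μ q m n x + μ) * 2 ^ (t + q) - coneMaxNat d Λ μ q m n t z| ≤ 2 * Λ * d := by
  rw [coneMax, sub_add_cancel]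
  refine abs_maxBelow_sub_le (by positivity) (by positivity) fun i _ => ?_
  set D : ℕ → ℕ := fun j => digit (2 ^ (q + 2 * μ + 1)) m (i * (d + 1) + j)
  have hD : ∀ j, (D j : ℝ) / 2 ^ q * 2 ^ (t + q) = D j * 2 ^ t := fun j => by
    rw [pow_add]; field_simp
  have hB : ((Λ * ∑ j ∈ Finset.range d, ((z j - D j * 2 ^ t) + (D j * 2 ^ t - z j)) : ℕ) : ℝ) =
      Λ * ∑ j : Fin d, |(z j : ℝ) - D j * 2 ^ t| := by
    rw [Nat.cast_mul, Nat.cast_sum, Finset.sum_range]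
    congr 1
    refine Finset.sum_congr rfl fun j _ => ?_
    rw [cast_sub_add_sub]
    push_cast
    rfl
  change |((D d : ℝ) / 2 ^ q - Λ * ∑ j : Fin d, |x.1 j - (D j : ℝ) / 2 ^ q|) * 2 ^ (t + q) -
    (((D d * 2 ^ t : ℕ) : ℝ) - ((Λ * ∑ j ∈ Finset.range d,
      ((z j - D j * 2 ^ t) + (D j * 2 ^ t - z j)) : ℕ) : ℝ))| ≤ _
  have hA : ∀ j : Fin d, |x.1 j - (D j : ℝ) / 2 ^ q| * 2 ^ (t + q) =
      |x.1 j * 2 ^ (t + q) - D j * 2 ^ t| := fun j => by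
    rw [← hD, ← sub_mul, abs_mul, abs_of_pos (a := (2 : ℝ) ^ (t + q)) (by positivity)]
  rw [hB, sub_mul, hD, mul_assoc, Finset.sum_mul]
  simp only [hA]
  push_cast
  have : (D d : ℝ) * 2 ^ t - Λ * ∑ j : Fin d, |x.1 j * 2 ^ (t + q) - D j * 2 ^ t| -
      (D d * 2 ^ t - Λ * ∑ j : Fin d, |(z j : ℝ) - D j * 2 ^ t|) =
      Λ * ∑ j : Fin d, (|(z j : ℝ) - D j * 2 ^ t| - |x.1 j * 2 ^ (t + q) - D j * 2 ^ t|) := by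
    rw [Finset.sum_sub_distrib]; ring
  rw [this, abs_mul, Nat.abs_cast, mul_assoc, mul_left_comm]
  refine mul_le_mul_of_nonneg_left ?_ (Nat.cast_nonneg _)
  calc |∑ j : Fin d, (|(z j : ℝ) - D j * 2 ^ t| - |x.1 j * 2 ^ (t + q) - D j * 2 ^ t|)|
      ≤ ∑ j : Fin d, |(|(z j : ℝ) - D j * 2 ^ t| - |x.1 j * 2 ^ (t + q) - D j * 2 ^ t|)| :=
        Finset.abs_sum_le_sum_abs _ _
    _ ≤ ∑ _j : Fin d, (2 : ℝ) := by
        refine Finset.sum_le_sum fun j _ => (abs_abs_sub_abs_le _ _).trans ?_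
        rw [sub_sub_sub_cancel_right, abs_sub_comm]
        exact hz j
    _ = 2 * d := by simp [mul_comm]

/-- The number of the rational number that a program for a maximum of cones outputs for the
accuracy `k` when it reads the numbers `ys` of the coordinates of a rational point. -/
def coneOutput (d Λ μ : ℕ) (a : List Bool × ℕ) (ys : List ℕ) : ℕ :=
  Nat.pair (Nat.pair
    (coneMaxNat d Λ μ (resolution a.1) (payload a.1) a.1.length (a.2 + 2 * Λ * d)
      fun j => roundCoord (2 ^ (a.2 + 2 * Λ * d + resolution a.1)) (ys.getD j 0))
    (μ * 2 ^ (a.2 + 2 * Λ * d + resolution a.1))) (2 ^ (a.2 + 2 * Λ * d + resolution a.1) - 1)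

/-- The machine whose programs describe maxima of cones. -/
def coneMachine (d Λ μ : ℕ) : Machine := fun p α k =>
  if IsDelimited p then
    Part.some (coneOutput d Λ μ (p, k)
      ((List.range d).map fun j => α (Nat.pair (k + 2 * Λ * d + resolution p) j)))
  else Part.none

theorem primrec_resolution : Primrec resolution := primrec_ones.comp primrec_afterOnes

theorem primrec_payload : Primrec payload :=
  primrec_bitsVal.comp (primrec_afterOnes.comp primrec_afterOnes)

theorem primrec_coneOutput (d Λ μ : ℕ) : Primrec₂ (coneOutput d Λ μ) := by
  have hp : Primrec fun a : (List Bool × ℕ) × List ℕ => a.1.1 := Primrec.fst.comp Primrec.fst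
  have hq := primrec_resolution.comp hp
  have hm := primrec_payload.comp hp
  have ht : Primrec fun a : (List Bool × ℕ) × List ℕ => a.1.2 + 2 * Λ * d :=
    Primrec.nat_add.comp (Primrec.snd.comp Primrec.fst) (Primrec.const _)
  have hpow := primrec_pow.comp (Primrec.const 2) ht
  have hT := primrec_pow.comp (Primrec.const 2) (Primrec.nat_add.comp ht hq)
  have hb := primrec_pow.comp (Primrec.const 2)
    (Primrec.succ.comp (Primrec.nat_add.comp hq (Primrec.const (2 * μ))))
  have hD : Primrec₂ fun (a : (List Bool × ℕ) × List ℕ) (i : ℕ) =>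
      digit (2 ^ (resolution a.1.1 + 2 * μ + 1)) (payload a.1.1) i :=
    (primrec_digit (hb.comp Primrec.fst) (hm.comp Primrec.fst) Primrec.snd).to₂
  have hz : Primrec₂ fun (a : (List Bool × ℕ) × List ℕ) (j : ℕ) =>
      roundCoord (2 ^ (a.1.2 + 2 * Λ * d + resolution a.1.1)) (a.2.getD j 0) :=
    (primrec_roundCoord.comp (hT.comp Primrec.fst)
      ((Primrec.list_getD 0).comp (Primrec.snd.comp Primrec.fst) Primrec.snd)).to₂
  have hi : Primrec₂ fun (i j : ℕ) => i * (d + 1) + j :=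
    (Primrec.nat_add.comp (Primrec.nat_mul.comp Primrec.fst (Primrec.const _)) Primrec.snd).to₂
  have hsum : Primrec₂ fun (b : ((List Bool × ℕ) × List ℕ) × ℕ) (j : ℕ) =>
      (roundCoord (2 ^ (b.1.1.2 + 2 * Λ * d + resolution b.1.1.1)) (b.1.2.getD j 0) -
        digit (2 ^ (resolution b.1.1.1 + 2 * μ + 1)) (payload b.1.1.1) (b.2 * (d + 1) + j) *
          2 ^ (b.1.1.2 + 2 * Λ * d)) +
      (digit (2 ^ (resolution b.1.1.1 + 2 * μ + 1)) (payload b.1.1.1) (b.2 * (d + 1) + j) *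
          2 ^ (b.1.1.2 + 2 * Λ * d) -
        roundCoord (2 ^ (b.1.1.2 + 2 * Λ * d + resolution b.1.1.1)) (b.1.2.getD j 0)) := by
    have h1 := hz.comp (Primrec.fst.comp (Primrec.fst : Primrec (Prod.fst :
      (((List Bool × ℕ) × List ℕ) × ℕ) × ℕ → _))) Primrec.snd
    have h2 := Primrec.nat_mul.comp (hD.comp (Primrec.fst.comp (Primrec.fst : Primrec (Prod.fst :
      (((List Bool × ℕ) × List ℕ) × ℕ) × ℕ → _)))
      (hi.comp (Primrec.snd.comp Primrec.fst) Primrec.snd))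
      (hpow.comp (Primrec.fst.comp Primrec.fst))
    exact (Primrec.nat_add.comp (Primrec.nat_sub.comp h1 h2) (Primrec.nat_sub.comp h2 h1)).to₂
  have hterm := (Primrec.nat_sub.comp
    (Primrec.nat_mul.comp (hD.comp Primrec.fst (hi.comp Primrec.snd (Primrec.const d)))
      (hpow.comp Primrec.fst))
    (Primrec.nat_mul.comp (Primrec.const Λ) (primrec_sum (Primrec.const d) hsum))).to₂
  have hmax := primrec_maxBelow (Primrec.list_length.comp hp) hterm
  exact (Primrec₂.natPair.comp (Primrec₂.natPair.comp hmax
    (Primrec.nat_mul.comp (Primrec.const μ) hT)) (Primrec.nat_sub.comp hT (Primrec.const 1))).to₂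

theorem coneMachine_isEffective (d Λ μ : ℕ) : (coneMachine d Λ μ).IsEffective :=
  Machine.isEffective_of_primrec d primrecPred_isDelimited
    (Primrec.nat_add.comp (Primrec.nat_add.comp Primrec.snd (Primrec.const (2 * Λ * d)))
      (primrec_resolution.comp Primrec.fst)) (primrec_coneOutput d Λ μ)

theorem coneMachine_isPrefixFree (d Λ μ : ℕ) : (coneMachine d Λ μ).IsPrefixFree := by
  intro α k p p' hp hp' h
  have aux : ∀ p, (coneMachine d Λ μ p α k).Dom → IsDelimited p := by
    intro p hp
    by_contra hn
    simp [coneMachine, hn] at hp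
  exact (aux p hp).eq_of_prefix (aux p' hp') h

/-- Reading the input at precision `2⁻¹ ^ (t + q)` gives coordinates with scaled error at most `2`,
hence an output error of at most `2 * Λ * d / 2 ^ (t + q)`. The summand `2 * Λ * d` in `t` pushes
this below `2⁻¹ ^ k`. -/
theorem coneMachine_computes (d Λ μ : ℕ) {p : List Bool} (hp : IsDelimited p) :
    Computes (coneMachine d Λ μ p) (coneMax d Λ μ (resolution p) (payload p) p.length) := by
  intro x α hα k
  refine ⟨_, by rw [coneMachine, if_pos hp]; exact Part.mem_some _, ?_⟩
  set q := resolution p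
  set t := k + 2 * Λ * d with ht
  set ys := (List.range d).map fun j => α (Nat.pair (t + q) j) with hys
  have hget : ∀ j : Fin d, ys.getD j 0 = α (Nat.pair (t + q) j) := by
    intro j
    simp [hys]
  have hz : ∀ j : Fin d,
      |x.1 j * 2 ^ (t + q) - (roundCoord (2 ^ (t + q)) (ys.getD j 0) : ℕ)| ≤ 2 := by
    intro j
    have h1 := (coord_abs_sub_le_dist x.1 (oraclePoint d α (t + q)) j).trans (hα (t + q)).le
    have h2 := abs_mul_sub_roundCoord_le (x.2 j).1 (2 ^ (t + q))
      (a := α (Nat.pair (t + q) j)) h1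
    rw [hget]
    push_cast at h2
    rw [← mul_pow, inv_mul_cancel₀ two_ne_zero, one_pow] at h2
    linarith
  have hmain := abs_coneMax_sub_coneMaxNat_le (Λ := Λ) (μ := μ) (m := payload p) (n := p.length)
    (z := fun j => roundCoord (2 ^ (t + q)) (ys.getD j 0)) hz
  set G := coneMaxNat d Λ μ q (payload p) p.length t
    fun j => roundCoord (2 ^ (t + q)) (ys.getD j 0) with hG
  have hout : ((ratOfNat (coneOutput d Λ μ (p, k) ys) : ℚ) : ℝ) =
      ((G : ℝ) - μ * 2 ^ (t + q)) / 2 ^ (t + q) := by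
    have h1 : coneOutput d Λ μ (p, k) ys =
      Nat.pair (Nat.pair G (μ * 2 ^ (t + q))) (2 ^ (t + q) - 1) := rfl
    rw [h1, ratOfNat]
    simp only [Nat.unpair_pair]
    push_cast [Nat.one_le_two_pow]
    ring
  rw [hout]
  have hT : (0 : ℝ) < 2 ^ (t + q) := by positivity
  set g := coneMax d Λ μ q (payload p) p.length x
  have h3 : g - ((G : ℝ) - μ * 2 ^ (t + q)) / 2 ^ (t + q) =
      ((g + μ) * 2 ^ (t + q) - G) / 2 ^ (t + q) := by
    field_simp
    ring
  rw [h3, abs_div, abs_of_pos hT, div_lt_iff₀ hT]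
  have h4 : (2 * Λ * d : ℝ) < 2 ^ (2 * Λ * d) := by
    exact_mod_cast Nat.lt_two_pow_self (n := 2 * Λ * d)
  have h5 : (2 : ℝ)⁻¹ ^ k * 2 ^ (t + q) = 2 ^ (2 * Λ * d) * 2 ^ q := by
    rw [ht, pow_add, pow_add, ← mul_assoc, ← mul_assoc, ← mul_pow, inv_mul_cancel₀ two_ne_zero,
      one_pow, one_mul]
  rw [h5]
  calc _ ≤ (2 * Λ * d : ℝ) := hmain
    _ < 2 ^ (2 * Λ * d) := h4
    _ ≤ 2 ^ (2 * Λ * d) * 2 ^ q :=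
      le_mul_of_one_le_right (by positivity) (one_le_pow₀ one_le_two)

/-- Maxima of cones have short programs. -/
theorem exists_coneMachine_program (d Λ μ q n : ℕ) {m : ℕ}
    (hm : m < (2 ^ (q + 2 * μ + 1)) ^ ((d + 1) * n)) :
    ∃ p : List Bool, p.length = 2 * (q + 1 + (q + 2 * μ + 1) * ((d + 1) * n)) + 1 ∧
      Computes (coneMachine d Λ μ p) (coneMax d Λ μ q m p.length) := by
  rw [← pow_mul] at hm
  obtain ⟨w, hw, rfl⟩ := exists_bitsVal _ m hm
  set ℓ := q + 1 + (q + 2 * μ + 1) * ((d + 1) * n)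
  -- The inner block gives `q` in unary, which is cheap since `q` is logarithmic in `1 / δ`; the
  -- outer block makes the word self-delimiting at the price of doubling its length.
  let w' := List.replicate q true ++ false :: w
  let p := List.replicate ℓ true ++ false :: w'
  have hlen : p.length = 2 * ℓ + 1 := by
    simp only [p, w', List.length_append, List.length_replicate, List.length_cons, hw]
    omega
  have hones : ones p = ℓ := ones_replicate _ _
  have hafter : afterOnes p = w' := afterOnes_replicate _ _
  have hres : resolution p = q := by rw [resolution, hafter]; exact ones_replicate _ _
  have hpay : payload p = bitsVal w := by rw [payload, hafter, afterOnes_replicate]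
  refine ⟨p, hlen, ?_⟩
  have := coneMachine_computes d Λ μ (p := p) (by rw [IsDelimited, hones, hlen])
  rwa [hres, hpay] at this

/-! ### Approximation of Lipschitz functions -/

/-- Ensures that the infimum defining `boxCount` is attained rather than being the default `0` of an
empty set. -/
theorem exists_box_cover {d : ℕ} (S : Set (Cube d)) {ε : ℝ} (hε : 0 < ε) :
    ∃ C : Finset (EuclideanSpace ℝ (Fin d)), Subtype.val '' S ⊆ ⋃ c ∈ C, box c ε := by
  classical
  have hb : Bornology.IsBounded (Subtype.val '' S : Set (EuclideanSpace ℝ (Fin d))) := by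
    refine (Metric.isBounded_iff_subset_closedBall 0).2 ⟨d, ?_⟩
    rintro _ ⟨x, -, rfl⟩
    rw [Metric.mem_closedBall]
    refine (dist_le_sum_abs_sub _ _).trans ?_
    calc ∑ j, |x.1 j - (0 : EuclideanSpace ℝ (Fin d)) j| ≤ ∑ _j : Fin d, (1 : ℝ) := by
          refine Finset.sum_le_sum fun j _ => ?_
          rw [PiLp.zero_apply, sub_zero, abs_of_nonneg (x.2 j).1]
          exact (x.2 j).2
      _ = d := by simp
  obtain ⟨t, ht, hcov⟩ := Metric.totallyBounded_iff.1
    (Metric.isCompact_of_isClosed_isBounded isClosed_closure hb.closure).totallyBounded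
    (ε / 2) (half_pos hε)
  let sh : EuclideanSpace ℝ (Fin d) := WithLp.toLp 2 fun _ => ε / 2
  refine ⟨ht.toFinset.image fun y => y - sh, fun x hx => ?_⟩
  obtain ⟨y, hy, hxy⟩ := mem_iUnion₂.1 (hcov (subset_closure hx))
  refine mem_iUnion₂.2 ⟨y - sh, Finset.mem_image_of_mem _ (ht.mem_toFinset.2 hy), fun j => ?_⟩
  have h := abs_le.1 ((coord_abs_sub_le_dist x y j).trans (Metric.mem_ball.1 hxy).le)
  have hj : (y - sh) j = y j - ε / 2 := rfl
  rw [hj]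
  constructor <;> linarith [h.1, h.2]

/-- As many points as there are boxes in a minimal cover suffice to approximate all points. -/
theorem exists_net {d : ℕ} (S : Set (Cube d)) {ε : ℝ} (hε : 0 < ε) :
    ∃ y : ℕ → Cube d, ∀ x ∈ S, ∃ i < boxCount (Subtype.val '' S) ε,
      ∀ j, |x.1 j - (y i).1 j| ≤ ε := by
  classical
  obtain ⟨C₀, hC₀⟩ := exists_box_cover S hε
  obtain ⟨C, hC, hcov⟩ := Nat.sInf_mem (s := {n : ℕ | ∃ C : Finset (EuclideanSpace ℝ (Fin d)),
    C.card = n ∧ Subtype.val '' S ⊆ ⋃ c ∈ C, box c ε}) ⟨_, C₀, rfl, hC₀⟩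
  change C.card = boxCount (Subtype.val '' S) ε at hC
  rw [← hC]
  let P : ℕ → Cube d → Prop := fun i x =>
    x ∈ S ∧ ∃ h : i < C.card, x.1 ∈ box (C.equivFin.symm ⟨i, h⟩).1 ε
  rcases S.eq_empty_or_nonempty with rfl | ⟨x₀, -⟩
  · exact ⟨fun _ => ⟨0, fun i => by simp⟩, by simp⟩
  -- The default `x₀` is used only for boxes that miss `S`, which are never needed.
  refine ⟨fun i => if h : ∃ x, P i x then h.choose else x₀, fun x hx => ?_⟩
  obtain ⟨c, hc, hxc⟩ := mem_iUnion₂.1 (hcov (mem_image_of_mem _ hx))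
  set i := C.equivFin ⟨c, hc⟩
  have hPx : P i x := ⟨hx, i.2, by simpa [i] using hxc⟩
  have hex : ∃ x, P i x := ⟨x, hPx⟩
  refine ⟨i, i.2, fun j => ?_⟩
  have hbox : ∀ z, P i z → z.1 ∈ box c ε := by
    rintro z ⟨-, _, h⟩
    simpa [i] using h
  have h1 := hbox x hPx j
  have h2 := hbox _ hex.choose_spec j
  dsimp only
  rw [dif_pos hex, abs_le]
  constructor <;> linarith [h1.1, h1.2, h2.1, h2.2]

theorem abs_sub_le_sum_of_lipschitzWith {d : ℕ} {L : ℝ≥0} {f : Cube d → ℝ} (hf : LipschitzWith L f)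
    (x y : Cube d) : |f x - f y| ≤ ⌈L⌉₊ * ∑ j, |x.1 j - y.1 j| := by
  rw [← Real.dist_eq]
  refine (hf.dist_le_mul x y).trans (mul_le_mul ?_ (dist_le_sum_abs_sub _ _) dist_nonneg
    (Nat.cast_nonneg _))
  exact_mod_cast Nat.le_ceil L

/-- Rounding down to a multiple of `2⁻¹ ^ q`. -/
theorem floor_div_bounds {x : ℝ} (hx : 0 ≤ x) (q : ℕ) :
    (⌊x * 2 ^ q⌋₊ : ℝ) / 2 ^ q ≤ x ∧ x - (2 ^ q)⁻¹ ≤ (⌊x * 2 ^ q⌋₊ : ℝ) / 2 ^ q := by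
  have hq : (0 : ℝ) < 2 ^ q := by positivity
  constructor
  · rw [div_le_iff₀ hq]
    exact Nat.floor_le (by positivity)
  · rw [le_div_iff₀ hq, sub_mul, inv_mul_cancel₀ hq.ne']
    linarith [Nat.lt_floor_add_one (x * 2 ^ q)]

/-- Lipschitz functions are approximated on a set by maxima of cones, one cone for each box of a
minimal cover of that set. -/
theorem exists_coneMax_approx {d : ℕ} (S : Set (Cube d)) {f : Cube d → ℝ} {Λ μ : ℕ}
    (hf : ∀ x y, |f x - f y| ≤ Λ * ∑ j, |x.1 j - y.1 j|) (hμ : ∀ x, |f x| ≤ μ) (q : ℕ) :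
    ∃ m < (2 ^ (q + 2 * μ + 1)) ^ ((d + 1) * boxCount (Subtype.val '' S) (2 ^ q)⁻¹),
      ∀ n, boxCount (Subtype.val '' S) (2 ^ q)⁻¹ ≤ n → ∀ x ∈ S,
        |f x - coneMax d Λ μ q m n x| ≤ (4 * Λ * d + 1) * (2 ^ q)⁻¹ := by
  have hq : (0 : ℝ) < 2 ^ q := by positivity
  obtain ⟨y, hy⟩ := exists_net S (inv_pos.2 hq)
  set N := boxCount (Subtype.val '' S) (2 ^ q)⁻¹
  -- Rounding coordinates down keeps the apices inside the cube, where `f` is defined.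
  let c : ℕ → Fin d → ℕ := fun i j => ⌊(y i).1 j * 2 ^ q⌋₊
  have hc : ∀ i j, (c i j : ℝ) / 2 ^ q ≤ (y i).1 j ∧
      (y i).1 j - (2 ^ q)⁻¹ ≤ (c i j : ℝ) / 2 ^ q := fun i j => floor_div_bounds ((y i).2 j).1 q
  let z : ℕ → Cube d := fun i => ⟨WithLp.toLp 2 fun j => (c i j : ℝ) / 2 ^ q,
    fun j => ⟨by positivity, (hc i j).1.trans ((y i).2 j).2⟩⟩
  have hz : ∀ i j, (z i).1 j = (c i j : ℝ) / 2 ^ q := fun i j => rfl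
  have hpos : ∀ x, 0 ≤ f x + μ := fun x => by linarith [(abs_le.1 (hμ x)).1]
  let v : ℕ → ℕ := fun i => ⌊(f (z i) + μ) * 2 ^ q⌋₊
  have hv : ∀ i, (v i : ℝ) / 2 ^ q ≤ f (z i) + μ ∧
      f (z i) + μ - (2 ^ q)⁻¹ ≤ (v i : ℝ) / 2 ^ q := fun i => floor_div_bounds (hpos _) q
  -- Block `i` of `d + 1` digits holds the coordinates of the apex, then its height.
  let e : ℕ → ℕ := fun t =>
    if h : t % (d + 1) < d then c (t / (d + 1)) ⟨t % (d + 1), h⟩ else v (t / (d + 1))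
  have hdiv : ∀ i j, j < d + 1 → (i * (d + 1) + j) / (d + 1) = i := fun i j hj => by
    rw [mul_comm, Nat.mul_add_div (Nat.succ_pos d), Nat.div_eq_of_lt hj, add_zero]
  have hmod : ∀ i j, j < d + 1 → (i * (d + 1) + j) % (d + 1) = j := fun i j hj => by
    rw [mul_comm, Nat.mul_add_mod, Nat.mod_eq_of_lt hj]
  have hec : ∀ i (j : Fin d), e (i * (d + 1) + j) = c i j := by
    intro i j
    have hj : (j : ℕ) < d + 1 := by omega
    simp [e, hdiv i j hj, hmod i j hj]
  have hev : ∀ i, e (i * (d + 1) + d) = v i := by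
    intro i
    simp [e, hdiv i d (Nat.lt_succ_self d), hmod i d (Nat.lt_succ_self d)]
  have hbig : 2 * μ < 2 ^ (2 * μ + 1) :=
    Nat.lt_two_pow_self.trans (Nat.pow_lt_pow_right one_lt_two (Nat.lt_succ_self _))
  -- Coordinates are at most `1` and shifted heights at most `2 * μ`; this is what dictates the base
  -- `2 ^ (q + 2 * μ + 1)`.
  have hlt : ∀ r : ℝ, r ≤ max (1 : ℝ) (2 * μ) → ⌊r * 2 ^ q⌋₊ < 2 ^ (q + 2 * μ + 1) := by
    intro r hr
    have h1 : max (1 : ℝ) (2 * μ) < 2 ^ (2 * μ + 1) :=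
      max_lt (one_lt_pow₀ one_lt_two (Nat.succ_ne_zero _)) (by exact_mod_cast hbig)
    rw [Nat.floor_lt' (by positivity)]
    push_cast
    rw [add_assoc, pow_add, mul_comm]
    exact mul_lt_mul_of_pos_left (hr.trans_lt h1) hq
  have he : ∀ t, e t < 2 ^ (q + 2 * μ + 1) := by
    intro t
    dsimp only [e]
    split_ifs with h
    · exact hlt _ (((y _).2 _).2.trans (le_max_left _ _))
    · refine hlt _ (le_trans ?_ (le_max_right _ _))
      linarith [(abs_le.1 (hμ (z (t / (d + 1))))).2]
  obtain ⟨m, hm, hdig⟩ := exists_digits ((d + 1) * N) e fun t _ => he t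
  refine ⟨m, hm, fun n hn x hx => ?_⟩
  have hidx : ∀ i < N, ∀ j < d + 1, i * (d + 1) + j < (d + 1) * N := fun i hi j hj =>
    calc i * (d + 1) + j < i * (d + 1) + (d + 1) := by omega
      _ = (d + 1) * (i + 1) := by ring
      _ ≤ (d + 1) * N := Nat.mul_le_mul_left _ hi
  have hterm : ∀ i < N, (digit (2 ^ (q + 2 * μ + 1)) m (i * (d + 1) + d) : ℝ) / 2 ^ q -
      Λ * ∑ j : Fin d, |x.1 j - (digit (2 ^ (q + 2 * μ + 1)) m (i * (d + 1) + j) : ℝ) / 2 ^ q| =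
      (v i : ℝ) / 2 ^ q - Λ * ∑ j, |x.1 j - (z i).1 j| := by
    intro i hi
    rw [hdig _ (hidx i hi d (Nat.lt_succ_self d)), hev]
    congr 2
    refine Finset.sum_congr rfl fun j _ => ?_
    rw [hdig _ (hidx i hi j (by omega)), hec, hz]
  -- Encoded cones lie below `f + μ` by the Lipschitz bound and the downward rounding of heights.
  -- The remaining ones have height `0`, hence are nonpositive, while `f + μ ≥ 0`.
  have hupper : coneMax d Λ μ q m n x ≤ f x := by
    rw [coneMax, sub_le_iff_le_add]
    refine maxBelow_le (hpos x) fun i _ => ?_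
    rcases lt_or_ge i N with hi | hi
    · rw [hterm i hi]
      linarith [(hv i).1, (abs_le.1 (hf x (z i))).1]
    · have h0 : digit (2 ^ (q + 2 * μ + 1)) m (i * (d + 1) + d) = 0 := by
        refine digit_eq_zero (by positivity) hm ?_
        calc (d + 1) * N ≤ (d + 1) * i := Nat.mul_le_mul_left _ hi
          _ ≤ i * (d + 1) + d := by rw [mul_comm]; omega
      rw [h0, Nat.cast_zero, zero_div, zero_sub]
      refine le_trans (neg_nonpos.2 ?_) (hpos x)
      exact mul_nonneg (Nat.cast_nonneg _) (Finset.sum_nonneg fun j _ => abs_nonneg _)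
  obtain ⟨i, hi, hxy⟩ := hy x hx
  have hlower : (v i : ℝ) / 2 ^ q - Λ * ∑ j, |x.1 j - (z i).1 j| ≤ coneMax d Λ μ q m n x + μ := by
    rw [coneMax, sub_add_cancel, ← hterm i hi]
    exact le_maxBelow (F := fun i => (digit (2 ^ (q + 2 * μ + 1)) m (i * (d + 1) + d) : ℝ) / 2 ^ q -
      Λ * ∑ j : Fin d, |x.1 j - (digit (2 ^ (q + 2 * μ + 1)) m (i * (d + 1) + j) : ℝ) / 2 ^ q|)
      (hi.trans_le hn)
  -- Per coordinate, one `2⁻q` comes from the box and one from rounding the apex.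
  have hsum : Λ * ∑ j, |x.1 j - (z i).1 j| ≤ Λ * (d * (2 * (2 ^ q)⁻¹)) := by
    refine mul_le_mul_of_nonneg_left ?_ (Nat.cast_nonneg _)
    calc ∑ j, |x.1 j - (z i).1 j| ≤ ∑ _j : Fin d, 2 * ((2 : ℝ) ^ q)⁻¹ := by
          refine Finset.sum_le_sum fun j _ => ?_
          have h1 := abs_le.1 (hxy j)
          have h2 := hc i j
          rw [← hz] at h2
          rw [abs_le]
          constructor <;> linarith [h1.1, h1.2, h2.1, h2.2]
      _ = d * (2 * (2 ^ q)⁻¹) := by simp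
  -- The bound `hsum` enters twice, through the slope of the cone and through `f x - f (z i)`;
  -- rounding the height adds one more `2⁻q`.
  rw [abs_of_nonneg (by linarith)]
  have h1 := (hv i).2
  have h2 := (abs_le.1 (hf x (z i))).2
  nlinarith

/-! ### Bounds for the complexity of explanations -/

/-- The support has full measure, so a uniform error bound there bounds the expected error. -/
theorem explanationComplexity_le {U : Machine} {d : ℕ} {D : Measure (Cube d)}
    [IsProbabilityMeasure D] {f g : Cube d → ℝ} {δ : ℝ} {p : List Bool}
    (hp : Computes (U p) g) (hg : ∀ x ∈ D.support, |f x - g x| ≤ δ) :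
    explanationComplexity U D f δ ≤ p.length := by
  have hk : kolmogorov U g ≤ p.length := iInf₂_le p hp
  refine iInf₂_le p.length ⟨g, hk, ?_⟩
  calc expectedError D f g ≤ ∫⁻ _, ENNReal.ofReal δ ∂D := by
        refine lintegral_mono_ae ?_
        filter_upwards [Measure.support_mem_ae (μ := D)] with x hx
        exact ENNReal.ofReal_le_ofReal (hg x hx)
    _ = ENNReal.ofReal δ := by simp

theorem toENNReal_le_ofReal {a : ℕ∞} {n : ℕ} {r : ℝ} (ha : a ≤ n) (hn : (n : ℝ) ≤ r) :
    (a : ℝ≥0∞) ≤ ENNReal.ofReal r := by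
  refine (ENat.toENNReal_le.2 ha).trans ?_
  rw [ENat.toENNReal_coe, ← ENNReal.ofReal_natCast]
  exact ENNReal.ofReal_le_ofReal hn

/-- For `ε < 1` both logarithms are nonnegative, also when the count is `0`, since `Real.log 0 = 0`.
-/
theorem HasBoxDim.nonneg {d : ℕ} {S : Set (EuclideanSpace ℝ (Fin d))} {s : ℝ}
    (h : HasBoxDim S s) : 0 ≤ s := by
  refine ge_of_tendsto h ?_
  filter_upwards [Ioo_mem_nhdsGT one_pos] with ε hε
  exact div_nonneg (Real.log_natCast_nonneg _)
    (Real.log_nonneg (one_le_one_div hε.1 hε.2.le))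

theorem half_le_log_one_div {δ : ℝ} (h0 : 0 < δ) (h : δ ≤ 1 / 2) : 1 / 2 ≤ Real.log (1 / δ) := by
  have h2 : (2 : ℝ) ≤ 1 / δ := by rw [le_div_iff₀ h0]; linarith
  linarith [Real.log_two_gt_d9, Real.log_le_log two_pos h2]

theorem one_le_one_div_rpow {δ s : ℝ} (h0 : 0 < δ) (h : δ ≤ 1 / 2) (hs : 0 ≤ s) :
    1 ≤ (1 / δ) ^ s :=
  Real.one_le_rpow (one_le_one_div h0 (by linarith)) hs

/-- The size of a program with `n` cones of resolution `2⁻¹ ^ q`. -/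
theorem program_size_le {d μ c q n : ℕ} {a A P l : ℝ} (ha : 0 ≤ a) (hP : 1 ≤ P)
    (hl : 1 / 2 ≤ l) (hq : q ≤ a + 2 * l) (hn : n ≤ A * P) :
    ((2 * (q + 1 + (q + 2 * μ + 1) * ((d + 1) * n)) + 1 + c : ℕ) : ℝ) ≤
      (2 * (2 * a + 2) + 2 * (3 + c) + 2 * (d + 1) * (2 * a + 4 + 4 * μ) * A) * (P * l) := by
  -- Since `l ≥ 1 / 2`, an additive constant `b` is at most `2 * b * l`.
  have h1 : (q : ℝ) ≤ (2 * a + 2) * l := by nlinarith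
  have h2 : (q + 2 * μ + 1 : ℝ) ≤ (2 * a + 4 + 4 * μ) * l := by
    nlinarith [(Nat.cast_nonneg μ : (0 : ℝ) ≤ μ)]
  have hlP : l ≤ P * l := le_mul_of_one_le_left (by linarith) hP
  have h3 : (q : ℝ) ≤ (2 * a + 2) * (P * l) :=
    h1.trans (mul_le_mul_of_nonneg_left hlP (by linarith))
  have h4 : (3 + c : ℝ) ≤ 2 * (3 + c) * (P * l) := by
    nlinarith [(Nat.cast_nonneg c : (0 : ℝ) ≤ c)]
  have h5 : (q + 2 * μ + 1 : ℝ) * ((d + 1) * n) ≤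
      (2 * a + 4 + 4 * μ) * l * ((d + 1) * (A * P)) := by
    refine mul_le_mul h2 (mul_le_mul_of_nonneg_left hn (by positivity)) (by positivity) ?_
    exact mul_nonneg (by positivity) (by linarith)
  push_cast
  nlinarith

theorem exists_bound_of_isComputable {U : Machine} (hU : U.IsUniversal) {d : ℕ}
    {D : Measure (Cube d)} [IsProbabilityMeasure D] {s : ℝ} (hs : 0 ≤ s) {f : Cube d → ℝ}
    (hf : IsComputable f) :
    ∃ C : ℝ, 0 < C ∧ ∀ δ : ℝ, 0 < δ → δ ≤ 1 / 2 →
      (explanationComplexity U D f δ : ℝ≥0∞) ≤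
        ENNReal.ofReal (C * ((1 / δ) ^ s * Real.log (1 / δ))) := by
  obtain ⟨p, hp⟩ := hf.exists_program hU
  refine ⟨2 * p.length + 1, by positivity, fun δ h0 h => ?_⟩
  refine toENNReal_le_ofReal (explanationComplexity_le hp fun x _ => by simpa using h0.le) ?_
  have hl := half_le_log_one_div h0 h
  have hP := one_le_one_div_rpow h0 h hs
  have : 1 / 2 ≤ (1 / δ) ^ s * Real.log (1 / δ) :=
    hl.trans (le_mul_of_one_le_left (by linarith) hP)
  nlinarith [(Nat.cast_nonneg p.length : (0 : ℝ) ≤ p.length)]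

theorem exists_bound_of_lipschitz {U : Machine} (hU : U.IsUniversal) {d : ℕ}
    {D : Measure (Cube d)} [IsProbabilityMeasure D] {s : ℝ} (hs : 0 ≤ s)
    (hO : (fun ε : ℝ => (boxCount (suppSet D) ε : ℝ)) =O[𝓝[>] 0] fun ε : ℝ => ε ^ (-s))
    (L : ℝ≥0) (M : ℝ) :
    ∃ C : ℝ, 0 < C ∧ ∀ f : Cube d → ℝ, LipschitzWith L f → (∀ x, |f x| ≤ M) →
      ∀ δ : ℝ, 0 < δ → δ ≤ 1 / 2 →
        (explanationComplexity U D f δ : ℝ≥0∞) ≤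
          ENNReal.ofReal (C * ((1 / δ) ^ s * Real.log (1 / δ))) := by
  set Λ := ⌈L⌉₊
  set μ := ⌈M⌉₊
  obtain ⟨c, hc⟩ := hU.2.2 _ (coneMachine_isEffective d Λ μ) (coneMachine_isPrefixFree d Λ μ)
  obtain ⟨A, hA, hbound⟩ := hO.exists_pos
  obtain ⟨ε₀, hε₀, hε⟩ := mem_nhdsGT_iff_exists_Ioo_subset.1 hbound.bound
  replace hε₀ : 0 < ε₀ := hε₀
  set K : ℝ := 4 * Λ * d + 1 with hK
  have hK1 : 1 ≤ K := by rw [hK]; linarith [show (0 : ℝ) ≤ 4 * Λ * d by positivity]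
  -- At scales below `η * δ`, `ε₀` makes the box-count bound available and `K⁻¹` cancels the
  -- constant of the approximation error.
  set η : ℝ := min ε₀ K⁻¹
  have hη : 0 < η := lt_min hε₀ (by positivity)
  have hη1 : η ≤ 1 := (min_le_right _ _).trans (inv_le_one_of_one_le₀ hK1)
  set a : ℝ := 1 + 2 * Real.log (1 / η)
  have ha : 0 ≤ a := by
    have := Real.log_nonneg (one_le_one_div hη hη1)
    positivity
  refine ⟨2 * (2 * a + 2) + 2 * (3 + c) + 2 * (d + 1) * (2 * a + 4 + 4 * μ) * (A * (2 / η) ^ s),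
    by positivity, fun f hf hM δ h0 h => ?_⟩
  have hl := half_le_log_one_div h0 h
  have hP := one_le_one_div_rpow h0 h hs
  have hηδ : 0 < η * δ := mul_pos hη h0
  have hx1 : 1 ≤ 1 / (η * δ) := one_le_one_div hηδ (mul_le_one₀ hη1 h0.le (by linarith))
  -- Thus `2⁻q` is below `η * δ` but at least half of it: fine enough for the error, coarse enough
  -- for the box count.
  obtain ⟨r, hr, hr'⟩ := exists_nat_pow_near hx1 one_lt_two
  set q := r + 1 with hqdef
  have hq0 : (0 : ℝ) < 2 ^ q := by positivity
  have hinv : ((2 : ℝ) ^ q)⁻¹ < η * δ := by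
    rw [inv_lt_comm₀ hq0 hηδ, ← one_div]
    exact hr'
  have hq : (q : ℝ) ≤ a + 2 * Real.log (1 / δ) := by
    have h1 := Real.log_le_log (by positivity) hr
    rw [Real.log_pow, ← one_div_mul_one_div, Real.log_mul (by positivity) (by positivity)] at h1
    have h2 : (r : ℝ) * (1 / 2) ≤ r * Real.log 2 :=
      mul_le_mul_of_nonneg_left (by linarith [Real.log_two_gt_d9]) (Nat.cast_nonneg _)
    rw [hqdef]
    push_cast
    linarith
  set N := boxCount (suppSet D) (2 ^ q)⁻¹
  have hN : (N : ℝ) ≤ A * (2 / η) ^ s * (1 / δ) ^ s := by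
    have hlt : ((2 : ℝ) ^ q)⁻¹ < ε₀ :=
      calc _ < η * δ := hinv
        _ ≤ η := mul_le_of_le_one_right hη.le (by linarith)
        _ ≤ ε₀ := min_le_left _ _
    have h1 : ‖(N : ℝ)‖ ≤ A * ‖(((2 : ℝ) ^ q)⁻¹) ^ (-s)‖ := hε ⟨inv_pos.2 hq0, hlt⟩
    rw [Real.norm_natCast, Real.norm_of_nonneg (by positivity),
      Real.inv_rpow hq0.le, Real.rpow_neg hq0.le, inv_inv] at h1
    refine h1.trans ?_
    rw [mul_assoc, ← Real.mul_rpow (by positivity) (by positivity)]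
    refine mul_le_mul_of_nonneg_left (Real.rpow_le_rpow hq0.le ?_ hs) hA.le
    calc (2 : ℝ) ^ q = 2 * 2 ^ r := pow_succ' 2 r
      _ ≤ 2 * (1 / (η * δ)) := by linarith
      _ = 2 / η * (1 / δ) := by field_simp
  obtain ⟨m, hm, happ⟩ := exists_coneMax_approx D.support (Λ := Λ) (μ := μ) (f := f)
    (abs_sub_le_sum_of_lipschitzWith hf) (fun x => (hM x).trans (Nat.le_ceil M)) q
  obtain ⟨p, hlen, hp⟩ := exists_coneMachine_program d Λ μ q N hm
  obtain ⟨p', hlen', hp'⟩ := hc p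
  have hcomp : Computes (U p') (coneMax d Λ μ q m p.length) := by
    intro x α hα k
    rw [hp']
    exact hp x α hα k
  -- The machine reads `p.length` cones, so all `N` encoded ones are among them.
  have hNp : N ≤ p.length := by
    rw [hlen]
    have : N ≤ (q + 2 * μ + 1) * ((d + 1) * N) := by
      rw [← mul_assoc]
      exact Nat.le_mul_of_pos_left _ (by positivity)
    omega
  refine toENNReal_le_ofReal (n := p'.length) (explanationComplexity_le hcomp fun x hx => ?_) ?_
  · calc _ ≤ K * (2 ^ q)⁻¹ := happ _ hNp x hx
      _ ≤ K * (K⁻¹ * δ) := by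
          refine mul_le_mul_of_nonneg_left (hinv.le.trans ?_) (by linarith)
          exact mul_le_mul_of_nonneg_right (min_le_right _ _) h0.le
      _ = δ := by rw [← mul_assoc, mul_inv_cancel₀ (by linarith), one_mul]
  · refine le_trans ?_ (program_size_le (d := d) (μ := μ) (c := c) ha hP hl hq hN)
    rw [← hlen]
    exact_mod_cast hlen'

end Explain

theorem mainTheorem9 (U : Explain.Machine) (hU : U.IsUniversal) (d : ℕ)
    (D : Measure (Explain.Cube d)) [IsProbabilityMeasure D] (dB : ℝ) (hdB : dB < d)
    (hdim : Explain.HasBoxDim (Explain.suppSet D) dB) :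
    -- every computable model
    (∀ f : Explain.Cube d → ℝ, Explain.IsComputable f →
      ∃ C : ℝ, 0 < C ∧ ∀ δ : ℝ, 0 < δ → δ ≤ 1 / 2 →
        (Explain.explanationComplexity U D f δ : ℝ≥0∞) ≤
          ENNReal.ofReal (C * ((1 / δ) ^ dB * Real.log (1 / δ)))) ∧
    -- if `N(ε) = O(ε^(-dB))`: one constant for all bounded Lipschitz models, computable or not
    ((fun ε : ℝ => (Explain.boxCount (Explain.suppSet D) ε : ℝ)) =O[𝓝[>] 0]
        (fun ε : ℝ => ε ^ (-dB)) →
      ∀ (L : ℝ≥0) (M : ℝ), ∃ C : ℝ, 0 < C ∧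
        ∀ f : Explain.Cube d → ℝ, LipschitzWith L f → (∀ x, |f x| ≤ M) →
          ∀ δ : ℝ, 0 < δ → δ ≤ 1 / 2 →
            (Explain.explanationComplexity U D f δ : ℝ≥0∞) ≤
              ENNReal.ofReal (C * ((1 / δ) ^ dB * Real.log (1 / δ)))) :=
  ⟨fun _ hf => Explain.exists_bound_of_isComputable hU hdim.nonneg hf,
    fun hO L M => Explain.exists_bound_of_lipschitz hU hdim.nonneg hO L M⟩
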